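/- Let $k,n\ge 1$ be integers. Let $\xi_{1,k}(n)$ be the number of $n$-cycles $\omega\in\mathcal S_n$ such that the product $\omega\,(1\;2\;\cdots\;n)$ has exactly $k$ cycles, where fixed points count as cycles of length one (so that for $n=1$ the identity is the unique $1$-cycle). Let $C(m,k)$ denote the unsigned Stirling number of the first kind, that is, the number of permutations of an $m$-element set with exactly $k$ cycles. If $n-k$ is even, then \[ \xi_{1,k}(n)=\frac{2}{n(n+1)}\,C(n+1,k), \] and if $n-k$ is odd, then $\xi_{1,k}(n)=0$. -/

import Mathlib

namespace CycleProduct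

/-- The number of disjoint cycles of a permutation `π` of `Fin n`, fixed points being counted as
cycles of length one (`Equiv.Perm.partition` is the cycle type with fixed points included). -/
def cycleCount {n : ℕ} (π : Equiv.Perm (Fin n)) : ℕ :=
  Multiset.card π.partition.parts

/-- `ω` is an `n`-cycle: its cycle type, fixed points included, consists of the single part `n`.
For `n = 1` this is the identity of `Fin 1`. -/
def IsFullCycle {n : ℕ} (ω : Equiv.Perm (Fin n)) : Prop :=
  ω.partition.parts = {n}

instance {n : ℕ} (ω : Equiv.Perm (Fin n)) : Decidable (IsFullCycle ω) :=
  inferInstanceAs (Decidable (ω.partition.parts = {n}))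

/-- The unsigned Stirling number of the first kind `C(n, k)`: the number of permutations of an
`n`-element set with exactly `k` cycles. -/
def stirlingCount (n k : ℕ) : ℕ :=
  (Finset.univ.filter fun π : Equiv.Perm (Fin n) => cycleCount π = k).card

/-- `ξ_{1,k}(n)`: the number of `n`-cycles `ω` for which the product `ω (1 2 ⋯ n)` has exactly `k`
cycles. The cycle `(1 2 ⋯ n)` is `finRotate n`, the map `i ↦ i + 1` (cyclically) on `Fin n`. -/
def xi (n k : ℕ) : ℕ :=
  (Finset.univ.filter fun ω : Equiv.Perm (Fin n) =>
    IsFullCycle ω ∧ cycleCount (ω * finRotate n) = k).card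

end CycleProduct

/-!
The proof is an elementary double count in `S_{n+1}`. Write `N = n + 1`.

*The key fact* (`card_filter_single_orbit`). For `N ≥ 3` and `σ ∈ S_N`, let `f(σ)` be the number of
permutations `D` consisting of one fixed point and an `(N-1)`-cycle such that `D σ⁻¹` is an
`N`-cycle. Then `f(σ) = c (1 - sgn σ)`, where `N c` is the number of all such `D`. So `f` is
constant on the odd permutations.

The indicator function of the `N`-cycles is a signed sum over invariant sets: for any chosen
point `i`, `[C is an N-cycle] = ∑_S (-1)^(number of cycles of C on S)`, over the `C`-invariant sets
`S` not containing `i` (`sum_restrWeight`), because toggling an orbit that avoids `i` reverses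
the sign. Apply this to `C = D σ⁻¹`, and sum over `D` first. For `2 ≤ |S| ≤ N - 2` the sum vanishes
(`sum_restrWeight_eq_zero`), as suitable conjugations of `D` reverse the sign. The image of a point
under `D` is equidistributed (`card_mul_card_filter_apply_eq`), so the empty set contributes `N c`,
each of the `N - 1` singletons `-c`, and the complement of `i` contributes `-c sgn σ`.

*The count.* If `n - k` is even, permutations of `N` points with `k` cycles are odd, so the number
of pairs `(D, σ)` with `D σ⁻¹` an `N`-cycle and `σ` having `k` cycles is `2 c C(n+1, k)`. On the
other hand, the inverse `ω` of `D σ⁻¹` is an `N`-cycle with `σ = ω D`, and the number of such `ω` is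
the same for all `D`, by conjugation. For the `D` that fixes `0` and is `(1 2 ⋯ n)` on the other
points, deleting `0` from `ω` gives `n ξ(n, k)` (`fullCycleMulCount_decomposeFin`). Hence
`2 C(n+1, k) = n (n+1) ξ(n, k)`. If `n - k` is odd, no `ω` exists, by comparison of signs.
The case `n = 1`, in which `N = 2`, is computed directly.
-/

open Equiv Equiv.Perm

namespace CycleProduct

variable {α : Type*} [Fintype α] [DecidableEq α]

/-! ### The number of cycles -/

theorem card_parts_partition (e : Perm α) :
    Multiset.card e.partition.parts =
      Multiset.card e.cycleType + (Fintype.card α - e.cycleType.sum) := by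
  rw [parts_partition, Multiset.card_add, Multiset.card_replicate, sum_cycleType]

/-- Multiplying by a transposition `(x y)`, where `x` is a fixed point, inserts `x` into the cycle
of `y`. -/
theorem card_parts_swap_mul {e : Perm α} {x y : α} (hx : e x = x) (hxy : x ≠ y) :
    Multiset.card (swap x y * e).partition.parts + 1 = Multiset.card e.partition.parts := by
  rw [card_parts_partition, card_parts_partition]
  by_cases hy : e y = y
  · have hd : Disjoint (swap x y) e := by
      intro z
      by_cases hzx : z = x
      · exact Or.inr (hzx ▸ hx)
      by_cases hzy : z = y
      · exact Or.inr (hzy ▸ hy)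
      exact Or.inl (swap_apply_of_ne_of_ne hzx hzy)
    have hle := sum_cycleType_le (swap x y * e)
    rw [hd.cycleType_mul, (isCycle_swap hxy).cycleType, card_support_swap hxy] at hle ⊢
    simp only [Multiset.sum_add, Multiset.sum_singleton, Multiset.card_add,
      Multiset.card_singleton] at hle ⊢
    omega
  · -- `c` is the cycle of `y`, and `(x y) c` is again a cycle, one element longer
    set c := e.cycleOf y with hc
    have hcyc : c.IsCycle := isCycle_cycleOf e hy
    have hmem : c ∈ e.cycleFactorsFinset :=
      cycleOf_mem_cycleFactorsFinset_iff.2 (mem_support.2 hy)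
    have hd : Disjoint (e * c⁻¹) c := disjoint_mul_inv_of_mem_cycleFactorsFinset hmem
    have hcx : c x = x := by
      by_contra h
      have := mem_cycleFactorsFinset_support_le hmem (mem_support.2 h)
      exact mem_support.1 this hx
    have hxl : x ∉ e.toList y := fun h => by
      have := (mem_toList_iff.1 h).1.apply_eq_self_iff.2 hx
      exact hy this
    have hlen : 2 ≤ (e.toList y).length := by
      rw [length_toList]; exact hcyc.two_le_card_support
    obtain ⟨z, l, hl⟩ : ∃ z l, e.toList y = z :: l := by
      cases h : e.toList y with
      | nil => simp [h] at hlen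
      | cons z l => exact ⟨z, l, rfl⟩
    have hz : z = y := by
      have := toList_getElem_zero e y (mem_support.2 hy)
      simpa [hl] using this
    subst hz
    have hform : swap x z * c = (x :: z :: l).formPerm := by
      rw [List.formPerm_cons_cons, ← hl, formPerm_toList]
    have hnd : (x :: z :: l).Nodup := by
      rw [List.nodup_cons, ← hl]; exact ⟨hxl, nodup_toList e z⟩
    have hcyc' : (swap x z * c).IsCycle := by
      rw [hform]; exact List.isCycle_formPerm hnd (by simp)
    have hcard : (swap x z * c).support.card = c.support.card + 1 := by
      rw [hform, List.support_formPerm_of_nodup _ hnd (by simp), List.toFinset_card_of_nodup hnd,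
        List.length_cons, ← hl, length_toList]
    have hd' : Disjoint (swap x z * c) (e * c⁻¹) := by
      intro w
      rcases hd w with h | h
      · exact Or.inr h
      · by_cases hwx : w = x
        · right
          subst hwx
          rw [mul_apply, inv_eq_iff_eq.2 h.symm, hx]
        · left
          rw [mul_apply, h]
          refine swap_apply_of_ne_of_ne hwx ?_
          rintro rfl
          exact hy (by simpa [hc] using h)
    have he : e = c * (e * c⁻¹) := by
      rw [hd.symm.commute.eq]; group
    have hse : swap x z * e = (swap x z * c) * (e * c⁻¹) := by
      rw [mul_assoc, ← he]
    have hle := sum_cycleType_le (swap x z * e)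
    have hce : e.cycleType = c.cycleType + (e * c⁻¹).cycleType := by
      rw [← hd.symm.cycleType_mul, ← he]
    rw [hce]
    rw [hse, hd'.cycleType_mul, hcyc'.cycleType, hcard] at hle ⊢
    rw [hcyc.cycleType]
    simp only [Multiset.sum_add, Multiset.sum_singleton, Multiset.card_add,
      Multiset.card_singleton] at hle ⊢
    omega

theorem decomposeFin_symm_zero_eq_extendDomain {n : ℕ} (e : Perm (Fin n)) :
    decomposeFin.symm (0, e) = e.extendDomain (finSuccAboveEquiv (0 : Fin (n + 1))) := by
  ext x
  refine Fin.cases ?_ (fun i => ?_) x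
  · rw [decomposeFin_symm_apply_zero, extendDomain_apply_not_subtype _ _ (by simp)]
  · have := extendDomain_apply_image e (finSuccAboveEquiv (0 : Fin (n + 1))) i
    simp only [finSuccAboveEquiv_apply, Fin.succAbove_zero] at this
    rw [this, decomposeFin_symm_apply_succ, swap_self, refl_apply]

theorem cycleType_decomposeFin_symm_zero {n : ℕ} (e : Perm (Fin n)) :
    (decomposeFin.symm (0, e)).cycleType = e.cycleType := by
  rw [decomposeFin_symm_zero_eq_extendDomain, cycleType_extendDomain]

theorem decomposeFin_symm_eq_swap_mul {n : ℕ} (p : Fin (n + 1)) (e : Perm (Fin n)) :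
    decomposeFin.symm (p, e) = swap 0 p * decomposeFin.symm (0, e) := by
  ext x
  refine Fin.cases ?_ (fun i => ?_) x <;> simp

theorem decomposeFin_symm_mul_zero {n : ℕ} (p : Fin (n + 1)) (e f : Perm (Fin n)) :
    decomposeFin.symm (p, e) * decomposeFin.symm (0, f) = decomposeFin.symm (p, e * f) := by
  ext x
  refine Fin.cases ?_ (fun i => ?_) x <;> simp

theorem cycleCount_decomposeFin_symm_zero {n : ℕ} (e : Perm (Fin n)) :
    cycleCount (decomposeFin.symm (0, e)) = cycleCount e + 1 := by
  have := sum_cycleType_le e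
  rw [cycleCount, cycleCount, card_parts_partition, card_parts_partition,
    cycleType_decomposeFin_symm_zero]
  simp only [Fintype.card_fin] at this ⊢
  omega

theorem cycleCount_decomposeFin_symm {n : ℕ} {p : Fin (n + 1)} (hp : p ≠ 0) (e : Perm (Fin n)) :
    cycleCount (decomposeFin.symm (p, e)) = cycleCount e := by
  have h0 := cycleCount_decomposeFin_symm_zero e
  rw [decomposeFin_symm_eq_swap_mul]
  have := card_parts_swap_mul (decomposeFin_symm_apply_zero 0 e) hp.symm
  unfold cycleCount at h0 ⊢
  omega

theorem sign_eq_neg_one_pow {n : ℕ} (e : Perm (Fin n)) :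
    Perm.sign e = (-1) ^ (n + cycleCount e) := by
  have hle := sum_cycleType_le e
  rw [Fintype.card_fin] at hle
  rw [sign_of_cycleType, cycleCount, card_parts_partition, Fintype.card_fin,
    show n + (Multiset.card e.cycleType + (n - e.cycleType.sum)) =
      e.cycleType.sum + Multiset.card e.cycleType + 2 * (n - e.cycleType.sum) by omega,
    pow_add (-1 : ℤˣ) (_ + _), pow_mul, neg_one_sq, one_pow, mul_one]

theorem isFullCycle_iff_cycleCount_eq_one {n : ℕ} (e : Perm (Fin n)) :
    IsFullCycle e ↔ cycleCount e = 1 := by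
  constructor
  · intro h
    rw [cycleCount, h, Multiset.card_singleton]
  · intro h
    obtain ⟨a, ha⟩ := Multiset.card_eq_one.1 h
    have hs := e.partition.parts_sum
    rw [ha, Multiset.sum_singleton, Fintype.card_fin] at hs
    rw [IsFullCycle, ha, hs]

/-- A permutation is a full cycle exactly if it has a single orbit. -/
theorem isFullCycle_iff_forall_sameCycle {n : ℕ} (hn : 2 ≤ n) (e : Perm (Fin n)) :
    IsFullCycle e ↔ ∀ x y, e.SameCycle x y := by
  constructor
  · intro h x y
    have hct : e.cycleType = {n} := by
      rw [← filter_parts_partition_eq_cycleType, show e.partition.parts = {n} from h,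
        Multiset.filter_singleton, if_pos hn]
    have hc : e.IsCycle := card_cycleType_eq_one.1 (by rw [hct, Multiset.card_singleton])
    have hs : e.support = Finset.univ := by
      rw [← Finset.card_eq_iff_eq_univ, ← sum_cycleType, hct, Multiset.sum_singleton,
        Fintype.card_fin]
    exact hc.sameCycle (mem_support.1 (hs ▸ Finset.mem_univ x))
      (mem_support.1 (hs ▸ Finset.mem_univ y))
  · intro h
    have hne : ∀ x, e x ≠ x := by
      intro x hx
      have : Nontrivial (Fin n) := Fin.nontrivial_iff_two_le.2 hn
      obtain ⟨y, hy⟩ := exists_ne x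
      exact hy ((h x y).eq_of_left hx).symm
    have hs : e.support = Finset.univ := Finset.eq_univ_of_forall fun x => mem_support.2 (hne x)
    have hc : e.IsCycle := ⟨⟨0, by omega⟩, hne _, fun y _ => h _ y⟩
    rw [IsFullCycle, parts_partition, hc.cycleType, hs, Finset.card_univ, Fintype.card_fin,
      Nat.sub_self, Multiset.replicate_zero, add_zero]

/-! ### Signed sums over invariant sets -/

/-- `π` is the permutation that agrees with `C` on `S` and is the identity off `S`; such a `π`
exists only if `C` maps `S` onto itself. -/
def IsRestr (C : Perm α) (S : Finset α) (π : Perm α) : Prop :=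
  (∀ x ∈ S, π x = C x) ∧ ∀ x ∉ S, π x = x

instance (C : Perm α) (S : Finset α) (π : Perm α) : Decidable (IsRestr C S π) :=
  inferInstanceAs (Decidable (_ ∧ _))

/-- The number `(-1) ^ m`, where `m` is the number of cycles of the restriction of `C` to `S`, if
`C` maps `S` onto itself, and `0` otherwise. It is encoded as a sum with at most one term, over the
permutations `π` that restrict `C` to `S`. -/
def restrWeight (C : Perm α) (S : Finset α) : ℤ :=
  ∑ π : Perm α, if IsRestr C S π then (-1) ^ S.card * (sign π : ℤ) else 0

omit [Fintype α] in
theorem IsRestr.unique {C : Perm α} {S : Finset α} {π ρ : Perm α} (h : IsRestr C S π)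
    (h' : IsRestr C S ρ) : π = ρ := by
  ext x
  by_cases hx : x ∈ S
  · rw [h.1 x hx, h'.1 x hx]
  · rw [h.2 x hx, h'.2 x hx]

omit [Fintype α] in
theorem IsRestr.apply_mem_iff {C : Perm α} {S : Finset α} {π : Perm α} (h : IsRestr C S π)
    (x : α) : C x ∈ S ↔ x ∈ S := by
  have key : ∀ x, x ∈ S → C x ∈ S := by
    intro x hx
    by_contra hC
    have hfix : C x = x := π.injective ((h.2 _ hC).trans (h.1 x hx).symm)
    exact hC (hfix.symm ▸ hx)
  have himg : S.map C.toEmbedding = S := by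
    refine Finset.eq_of_subset_of_card_le (fun y hy => ?_) (by rw [Finset.card_map])
    obtain ⟨x, hx, rfl⟩ := Finset.mem_map.1 hy
    exact key x hx
  refine ⟨fun hx => ?_, key x⟩
  rw [← himg] at hx
  simpa using hx

theorem restrWeight_eq_of_isRestr {C : Perm α} {S : Finset α} {π : Perm α} (h : IsRestr C S π) :
    restrWeight C S = (-1) ^ S.card * (sign π : ℤ) := by
  rw [restrWeight, Finset.sum_eq_single π, if_pos h]
  · intro ρ _ hρ
    exact if_neg fun h' => hρ (h'.unique h)
  · simp

theorem restrWeight_eq_zero {C : Perm α} {S : Finset α} (h : ∀ π, ¬ IsRestr C S π) :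
    restrWeight C S = 0 :=
  Finset.sum_eq_zero fun π _ => if_neg (h π)

theorem apply_mem_iff_of_restrWeight_ne_zero {C : Perm α} {S : Finset α}
    (h : restrWeight C S ≠ 0) (x : α) : C x ∈ S ↔ x ∈ S := by
  by_cases hex : ∃ π, IsRestr C S π
  · exact hex.choose_spec.apply_mem_iff x
  · exact absurd (restrWeight_eq_zero (not_exists.1 hex)) h

/-- The weight changes its sign if `C` is followed, on `S`, by a transposition inside `S`. -/
theorem restrWeight_eq_neg_of_swap {C C' : Perm α} {S : Finset α} {u v : α} (hu : u ∈ S)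
    (hv : v ∈ S) (huv : u ≠ v) (h : ∀ x ∈ S, C' x = swap u v (C x)) :
    restrWeight C' S = -restrWeight C S := by
  have hoff : ∀ x ∉ S, swap u v x = x := fun x hx =>
    swap_apply_of_ne_of_ne (fun e => hx (e ▸ hu)) (fun e => hx (e ▸ hv))
  rw [restrWeight, restrWeight, ← Finset.sum_neg_distrib]
  refine (_root_.Equiv.sum_comp (Equiv.mulLeft (swap u v)) _).symm.trans ?_
  refine Finset.sum_congr rfl fun π _ => ?_
  have hiff : IsRestr C' S (swap u v * π) ↔ IsRestr C S π := by
    refine and_congr (forall₂_congr fun x hx => ?_) (forall₂_congr fun x hx => ?_)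
    · rw [h x hx, mul_apply, (swap u v).injective.eq_iff]
    · rw [mul_apply]
      nth_rewrite 2 [← hoff x hx]
      rw [(swap u v).injective.eq_iff]
  simp only [Equiv.coe_mulLeft, hiff]
  split_ifs
  · rw [Perm.sign_mul, sign_swap huv]; simp
  · simp

theorem restrWeight_empty (C : Perm α) : restrWeight C ∅ = 1 := by
  rw [restrWeight_eq_of_isRestr (π := 1) ⟨by simp, by simp⟩]
  simp

theorem restrWeight_singleton (C : Perm α) (s : α) :
    restrWeight C {s} = if C s = s then -1 else 0 := by
  split_ifs with h
  · rw [restrWeight_eq_of_isRestr (π := 1) ⟨by simp [h], by simp⟩]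
    simp
  · by_contra hne
    exact h (by simpa using apply_mem_iff_of_restrWeight_ne_zero hne s)

theorem restrWeight_erase (C : Perm α) (i : α) :
    restrWeight C (Finset.univ.erase i) =
      if C i = i then (-1) ^ (Fintype.card α - 1) * (sign C : ℤ) else 0 := by
  split_ifs with h
  · rw [restrWeight_eq_of_isRestr (π := C) ⟨by simp, by simp [h]⟩,
      Finset.card_erase_of_mem (Finset.mem_univ i), Finset.card_univ]
  · by_contra hne
    have := apply_mem_iff_of_restrWeight_ne_zero hne i
    simp [h] at this

/-- Adding an orbit of `C` to an invariant set disjoint from it changes the sign of the weight. -/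
theorem restrWeight_union_orbit (C : Perm α) (S O : Finset α) (j : α)
    (hO : ∀ x, x ∈ O ↔ C.SameCycle j x) (hd : _root_.Disjoint S O) :
    restrWeight C (S ∪ O) = -restrWeight C S := by
  have hcard : (-1 : ℤ) ^ O.card * (sign (C.cycleOf j) : ℤ) = -1 := by
    by_cases hj : C j = j
    · have hO1 : O = {j} := by
        ext x
        rw [hO, Finset.mem_singleton]
        exact ⟨fun h => (h.eq_of_left hj).symm, fun h => h ▸ SameCycle.refl _ _⟩
      rw [(cycleOf_eq_one_iff C).2 hj, hO1]; simp
    · have hO1 : O = (C.cycleOf j).support := by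
        ext x
        rw [hO, mem_support_cycleOf_iff' hj]
      rw [(isCycle_cycleOf C hj).sign, ← hO1]
      push_cast
      rw [mul_neg, ← mul_pow]; simp
  have hc : ∀ x, C.cycleOf j x = if x ∈ O then C x else x := by
    intro x
    rw [cycleOf_apply]
    simp only [hO]
  have hCO : ∀ x, C x ∈ O ↔ x ∈ O := fun x => by rw [hO, hO, sameCycle_apply_right]
  have hdis : ∀ x ∈ S, x ∉ O := fun x hx => Finset.disjoint_left.1 hd hx
  rw [restrWeight, restrWeight, ← Finset.sum_neg_distrib]
  refine (_root_.Equiv.sum_comp (Equiv.mulRight (C.cycleOf j)) _).symm.trans ?_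
  refine Finset.sum_congr rfl fun π _ => ?_
  have hiff : IsRestr C (S ∪ O) (π * C.cycleOf j) ↔ IsRestr C S π := by
    constructor
    · rintro ⟨h1, h2⟩
      refine ⟨fun x hx => ?_, fun x hx => ?_⟩
      · have := h1 x (Finset.mem_union_left _ hx)
        rwa [mul_apply, hc, if_neg (hdis x hx)] at this
      · by_cases hxO : x ∈ O
        · have hx' : C (C.symm x) = x := C.apply_symm_apply x
          have hxO' : C.symm x ∈ O := by rwa [← hCO, hx']
          have := h1 _ (Finset.mem_union_right _ hxO')
          rwa [mul_apply, hc, if_pos hxO', hx'] at this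
        · have := h2 x (by simp [hx, hxO])
          rwa [mul_apply, hc, if_neg hxO] at this
    · rintro ⟨h1, h2⟩
      refine ⟨fun x hx => ?_, fun x hx => ?_⟩
      · rw [mul_apply, hc]
        split_ifs with hxO
        · exact h2 _ fun hS => hdis _ hS ((hCO x).2 hxO)
        · exact h1 x ((Finset.mem_union.1 hx).resolve_right hxO)
      · rw [Finset.mem_union, not_or] at hx
        rw [mul_apply, hc, if_neg hx.2, h2 x hx.1]
  simp only [Equiv.coe_mulRight, hiff]
  split_ifs
  · rw [Finset.card_union_of_disjoint hd, Perm.sign_mul, pow_add]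
    push_cast
    linear_combination (-1) ^ S.card * (sign π : ℤ) * hcard
  · simp

/-- The indicator of the permutations with a single orbit, as a signed sum over the invariant sets
that avoid a given point `i`. It is the expansion of the principal minor of `1 - C` at `i`. -/
theorem sum_restrWeight (C : Perm α) (i : α) :
    ∑ S ∈ (Finset.univ.erase i).powerset, restrWeight C S =
      if ∀ x y, C.SameCycle x y then 1 else 0 := by
  split_ifs with hfull
  · rw [Finset.sum_eq_single ∅, restrWeight_empty]
    · intro S hS hne
      obtain ⟨x, hx⟩ := Finset.nonempty_iff_ne_empty.2 hne
      by_contra hw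
      have hi : i ∉ S := fun h => by
        simpa using Finset.mem_powerset.1 hS h
      obtain ⟨m, -, hm⟩ := (hfull x i).exists_pow_eq'
      have hpow : ∀ m : ℕ, (C ^ m) x ∈ S := by
        intro m
        induction m with
        | zero => simpa using hx
        | succ m ih =>
          rw [pow_succ', mul_apply]
          exact (apply_mem_iff_of_restrWeight_ne_zero hw _).2 ih
      exact hi (hm ▸ hpow m)
    · intro h
      simp at h
  · -- toggling an orbit that avoids `i` is a sign-reversing involution
    obtain ⟨j, hj⟩ : ∃ j, ¬ C.SameCycle j i := by
      by_contra h
      push Not at h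
      exact hfull fun x y => (h x).trans (h y).symm
    set O : Finset α := Finset.univ.filter fun x => C.SameCycle j x with hOdef
    have hO : ∀ x, x ∈ O ↔ C.SameCycle j x := fun x => by simp [hOdef]
    have hiO : i ∉ O := by rwa [hO]
    have hjO : j ∈ O := (hO j).2 (SameCycle.refl _ _)
    have hOstab : ∀ S : Finset α, restrWeight C S ≠ 0 → j ∈ S → O ⊆ S := by
      intro S hw hjS x hx
      obtain ⟨m, -, rfl⟩ := ((hO x).1 hx).exists_pow_eq'
      clear hx
      induction m with
      | zero => simpa using hjS
      | succ m ih =>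
        rw [pow_succ', mul_apply]
        exact (apply_mem_iff_of_restrWeight_ne_zero hw _).2 ih
    have hOdisj : ∀ S : Finset α, restrWeight C S ≠ 0 → j ∉ S → _root_.Disjoint S O := by
      intro S hw hjS
      refine Finset.disjoint_left.2 fun x hxS hxO => hjS ?_
      obtain ⟨m, -, rfl⟩ := ((hO x).1 hxO).exists_pow_eq'
      clear hxO
      induction m with
      | zero => simpa using hxS
      | succ m ih =>
        rw [pow_succ', mul_apply] at hxS
        exact ih ((apply_mem_iff_of_restrWeight_ne_zero hw _).1 hxS)
    rw [← Finset.sum_filter_ne_zero]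
    have hpow : ∀ S : Finset α, S ∈ (Finset.univ.erase i).powerset ↔ i ∉ S := by
      intro S
      rw [Finset.mem_powerset, Finset.subset_erase]
      simp
    have hsplit : ∀ S : Finset α, restrWeight C S ≠ 0 → j ∈ S →
        restrWeight C S = -restrWeight C (S \ O) := by
      intro S hw hjS
      rw [← restrWeight_union_orbit C (S \ O) O j hO Finset.sdiff_disjoint,
        Finset.sdiff_union_of_subset (hOstab S hw hjS)]
    refine Finset.sum_involution (fun S _ => if j ∈ S then S \ O else S ∪ O) ?_ ?_ ?_ ?_
    · intro S hS
      have hw := (Finset.mem_filter.1 hS).2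
      by_cases hjS : j ∈ S
      · simp only [if_pos hjS]
        rw [hsplit S hw hjS]; ring
      · simp only [if_neg hjS]
        rw [restrWeight_union_orbit C S O j hO (hOdisj S hw hjS)]; ring
    · intro S hS _ heq
      by_cases hjS : j ∈ S
      · simp only [if_pos hjS] at heq
        rw [← heq] at hjS
        exact (Finset.mem_sdiff.1 hjS).2 hjO
      · simp only [if_neg hjS] at heq
        rw [← heq] at hjS
        exact hjS (Finset.mem_union_right _ hjO)
    · intro S hS
      obtain ⟨hm, hw⟩ := Finset.mem_filter.1 hS
      rw [hpow] at hm
      rw [Finset.mem_filter, hpow]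
      by_cases hjS : j ∈ S
      · simp only [if_pos hjS]
        refine ⟨fun h => hm (Finset.mem_sdiff.1 h).1, fun h => hw ?_⟩
        rw [hsplit S hw hjS, h, neg_zero]
      · simp only [if_neg hjS]
        refine ⟨fun h => (Finset.mem_union.1 h).elim hm hiO, fun h => hw ?_⟩
        rw [restrWeight_union_orbit C S O j hO (hOdisj S hw hjS)] at h
        exact neg_eq_zero.1 h
    · intro S hS
      have hw := (Finset.mem_filter.1 hS).2
      by_cases hjS : j ∈ S
      · have : j ∉ S \ O := fun h => (Finset.mem_sdiff.1 h).2 hjO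
        simp only [if_pos hjS, if_neg this]
        exact Finset.sdiff_union_of_subset (hOstab S hw hjS)
      · have : j ∈ S ∪ O := Finset.mem_union_right _ hjO
        simp only [if_neg hjS, if_pos this]
        exact Finset.union_sdiff_cancel_right (hOdisj S hw hjS)

/-! ### Products of a full cycle with an odd permutation -/

variable (α) in
/-- The permutations of `α` that consist of a single fixed point and of one cycle through all other
points (for a set `α` of at least three elements). -/
def almostFullCycles : Finset (Perm α) :=
  Finset.univ.filter fun D => D.cycleType = {Fintype.card α - 1}

theorem mem_almostFullCycles {D : Perm α} :
    D ∈ almostFullCycles α ↔ D.cycleType = {Fintype.card α - 1} := by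
  simp [almostFullCycles]

theorem conj_mem_almostFullCycles (c : Perm α) {D : Perm α} :
    c * D * c⁻¹ ∈ almostFullCycles α ↔ D ∈ almostFullCycles α := by
  rw [mem_almostFullCycles, mem_almostFullCycles, cycleType_conj]

theorem sum_conj_almostFullCycles {M : Type*} [AddCommMonoid M] (c : Perm α) (f : Perm α → M) :
    ∑ D ∈ almostFullCycles α, f (c * D * c⁻¹) = ∑ D ∈ almostFullCycles α, f D := by
  refine Finset.sum_equiv (MulAut.conj c).toEquiv (fun D => ?_) (fun D _ => ?_)
  · exact (conj_mem_almostFullCycles c).symm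
  · simp

theorem isCycle_of_mem_almostFullCycles {D : Perm α} (hD : D ∈ almostFullCycles α) :
    D.IsCycle := by
  rw [mem_almostFullCycles] at hD
  rw [← card_cycleType_eq_one, hD, Multiset.card_singleton]

theorem card_support_of_mem_almostFullCycles {D : Perm α} (hD : D ∈ almostFullCycles α) :
    D.support.card = Fintype.card α - 1 := by
  rw [mem_almostFullCycles] at hD
  rw [← sum_cycleType, hD, Multiset.sum_singleton]

theorem sign_of_mem_almostFullCycles {D : Perm α} (hD : D ∈ almostFullCycles α) :
    (sign D : ℤ) = -(-1) ^ (Fintype.card α - 1) := by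
  rw [(isCycle_of_mem_almostFullCycles hD).sign, card_support_of_mem_almostFullCycles hD]
  simp

theorem card_fixed_of_mem_almostFullCycles [Nonempty α] {D : Perm α}
    (hD : D ∈ almostFullCycles α) :
    (Finset.univ.filter fun x => D x = x).card = 1 := by
  have h1 : (Finset.univ.filter fun x => D x = x) = D.supportᶜ := by ext; simp
  have := Fintype.card_pos (α := α)
  rw [h1, Finset.card_compl, card_support_of_mem_almostFullCycles hD]
  omega

theorem eq_of_apply_eq_self {D : Perm α} (hD : D ∈ almostFullCycles α) {x y : α} (hx : D x = x)
    (hy : D y = y) : x = y := by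
  have : Nonempty α := ⟨x⟩
  exact Finset.card_le_one.1 (card_fixed_of_mem_almostFullCycles hD).le x (by simpa using hx) y
    (by simpa using hy)

/-- A set that is mapped into itself cannot separate two points that are moved. -/
theorem not_mapsTo_of_mem_almostFullCycles {D : Perm α} (hD : D ∈ almostFullCycles α)
    {U : Finset α} {y z : α} (hU : ∀ x ∈ U, D x ∈ U) (hy : y ∈ U) (hz : z ∉ U) (hDy : D y ≠ y)
    (hDz : D z ≠ z) : False := by
  obtain ⟨m, -, rfl⟩ :=
    ((isCycle_of_mem_almostFullCycles hD).sameCycle hDy hDz).exists_pow_eq'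
  refine hz ?_
  clear hz hDz
  induction m with
  | zero => simpa using hy
  | succ m ih =>
    rw [pow_succ', mul_apply]
    exact hU _ ih

/-- Over the permutations with one fixed point and one further cycle, the image of a given point is
equidistributed. -/
theorem card_mul_card_filter_apply_eq (u v : α) :
    Fintype.card α * ((almostFullCycles α).filter fun D => D u = v).card =
      (almostFullCycles α).card := by
  have : Nonempty α := ⟨u⟩
  set c : α → α → ℕ := fun u v => ((almostFullCycles α).filter fun D => D u = v).card with hc
  have hconj : ∀ (g : Perm α) u v, c (g u) (g v) = c u v := by
    intro g u v
    simp only [hc, Finset.card_filter]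
    rw [← sum_conj_almostFullCycles g]
    refine Finset.sum_congr rfl fun D _ => ?_
    simp [mul_apply]
  have hdiag : ∀ u, Fintype.card α * c u u = (almostFullCycles α).card := by
    intro u
    -- each `D` has exactly one fixed point
    have hsum : ∑ x, c x x = (almostFullCycles α).card := by
      simp only [hc, Finset.card_filter]
      rw [Finset.sum_comm, Finset.card_eq_sum_ones]
      refine Finset.sum_congr rfl fun D hD => ?_
      rw [← Finset.card_filter, card_fixed_of_mem_almostFullCycles hD]
    have hcst : ∀ x, c x x = c u u := fun x => by
      have := hconj (swap x u) x x
      rw [swap_apply_left] at this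
      exact this.symm
    rw [← hsum, Finset.sum_congr rfl fun x _ => hcst x, Finset.sum_const, Finset.card_univ,
      smul_eq_mul]
  by_cases huv : u = v
  · subst huv
    exact hdiag u
  -- the points other than `u` are equivalent, and share equally what the diagonal term leaves
  · have hrow : ∑ x, c u x = (almostFullCycles α).card := by
      simp only [hc, Finset.card_filter]
      rw [Finset.sum_comm, Finset.card_eq_sum_ones]
      refine Finset.sum_congr rfl fun D hD => ?_
      simp
    have hcst : ∀ x ∈ Finset.univ.erase u, c u x = c u v := fun x hx => by
      have hxu := Finset.ne_of_mem_erase hx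
      have := hconj (swap x v) u x
      rw [swap_apply_left, swap_apply_of_ne_of_ne hxu.symm huv] at this
      exact this.symm
    rw [← Finset.add_sum_erase _ _ (Finset.mem_univ u), Finset.sum_congr rfl hcst,
      Finset.sum_const, Finset.card_erase_of_mem (Finset.mem_univ u), Finset.card_univ,
      smul_eq_mul] at hrow
    have hd := hdiag u
    have hpos : 2 ≤ Fintype.card α := Fintype.one_lt_card_iff.2 ⟨u, v, huv⟩
    obtain ⟨m, hm⟩ : ∃ m, Fintype.card α = m + 2 := ⟨_, (Nat.sub_add_cancel hpos).symm⟩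
    change Fintype.card α * c u v = _
    rw [hm] at hrow hd ⊢
    have h1 : (m + 1) * c u v = (m + 1) * c u u := by
      have : m + 2 - 1 = m + 1 := rfl
      rw [this] at hrow
      linarith
    rw [Nat.eq_of_mul_eq_mul_left (Nat.succ_pos m) h1, hd]

/-- A nonzero weight forces `D` to map `σ⁻¹ S` onto `S`. -/
theorem apply_mem_iff_of_restrWeight_mul_inv_ne_zero {D σ : Perm α} {S : Finset α}
    (h : restrWeight (D * σ⁻¹) S ≠ 0) (x : α) : D x ∈ S ↔ σ x ∈ S := by
  have := apply_mem_iff_of_restrWeight_ne_zero h (σ x)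
  rwa [mul_apply, show σ⁻¹ (σ x) = x from σ.symm_apply_apply x] at this

theorem restrWeight_mul_inv_eq_neg_of_swap {D D' σ : Perm α} {S : Finset α} {u v : α}
    (hu : u ∈ S) (hv : v ∈ S) (huv : u ≠ v)
    (h : ∀ x, σ x ∈ S → D' x = swap u v (D x)) :
    restrWeight (D' * σ⁻¹) S = -restrWeight (D * σ⁻¹) S := by
  refine restrWeight_eq_neg_of_swap hu hv huv fun x hx => ?_
  rw [mul_apply, mul_apply]
  exact h _ (by rwa [show σ (σ⁻¹ x) = x from σ.apply_symm_apply x])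

/-- If two points of `S` lie outside `σ⁻¹ S`, conjugation by their transposition cancels the
weights. -/
theorem sum_restrWeight_eq_zero_of_two {σ : Perm α} {S : Finset α} {u v : α} (hu : u ∈ S)
    (hv : v ∈ S) (huv : u ≠ v) (hσu : σ u ∉ S) (hσv : σ v ∉ S) :
    ∑ D ∈ almostFullCycles α, restrWeight (D * σ⁻¹) S = 0 := by
  have key : ∑ D ∈ almostFullCycles α, restrWeight (D * σ⁻¹) S =
      -∑ D ∈ almostFullCycles α, restrWeight (D * σ⁻¹) S := by
    nth_rewrite 1 [← sum_conj_almostFullCycles (swap u v)]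
    rw [← Finset.sum_neg_distrib]
    refine Finset.sum_congr rfl fun D _ => ?_
    refine restrWeight_mul_inv_eq_neg_of_swap hu hv huv fun x hx => ?_
    rw [mul_apply, mul_apply, swap_inv, swap_apply_of_ne_of_ne (a := u) (b := v) (x := x)]
    · rintro rfl; exact hσu hx
    · rintro rfl; exact hσv hx
  linarith

/-- If `σ` maps `S` into itself, all weights vanish, as `S` would be invariant under `D`. -/
theorem sum_restrWeight_eq_zero_of_mapsTo {σ : Perm α} {S : Finset α} (h2 : 2 ≤ S.card)
    (h2' : S.card + 2 ≤ Fintype.card α) (hσ : ∀ x ∈ S, σ x ∈ S) :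
    ∑ D ∈ almostFullCycles α, restrWeight (D * σ⁻¹) S = 0 := by
  refine Finset.sum_eq_zero fun D hD => ?_
  by_contra hw
  have hDS : ∀ x ∈ S, D x ∈ S := fun x hx =>
    (apply_mem_iff_of_restrWeight_mul_inv_ne_zero hw x).2 (hσ x hx)
  obtain ⟨p, hp, q, hq, hpq⟩ := Finset.one_lt_card.1 h2
  obtain ⟨p', hp', q', hq', hpq'⟩ := Finset.one_lt_card.1
    (show 1 < Sᶜ.card by rw [Finset.card_compl]; omega)
  rw [Finset.mem_compl] at hp' hq'
  obtain ⟨y, hy, hDy⟩ : ∃ y ∈ S, D y ≠ y := by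
    by_contra! h
    exact hpq (eq_of_apply_eq_self hD (h p hp) (h q hq))
  obtain ⟨z, hz, hDz⟩ : ∃ z, z ∉ S ∧ D z ≠ z := by
    by_contra! h
    exact hpq' (eq_of_apply_eq_self hD (h p' hp') (h q' hq'))
  exact not_mapsTo_of_mem_almostFullCycles hD hDS hy hz hDy hDz

/-- The case in which `S` and `σ⁻¹ S` differ by a single element, `b ∈ S` against `a ∈ σ⁻¹ S`.
Permutations `D` whose fixed point `x` lies in `S`, with `D b = y`, are paired with those whose
fixed point `y` lies outside `S`, with `D x = b`, through conjugation by the 3-cycle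
`b ↦ x ↦ y ↦ b`. -/
theorem sum_restrWeight_eq_zero_of_exchange {σ : Perm α} {S : Finset α} {a b : α}
    (h2 : 2 ≤ S.card) (h2' : S.card + 2 ≤ Fintype.card α) (hb : b ∈ S) (hσb : σ b ∉ S)
    (ha : a ∉ S) (hσa : σ a ∈ S) (hT : ∀ x, x ≠ a → x ≠ b → (σ x ∈ S ↔ x ∈ S)) :
    ∑ D ∈ almostFullCycles α, restrWeight (D * σ⁻¹) S = 0 := by
  have : Nonempty α := ⟨a⟩
  set w : Perm α → ℤ := fun D => restrWeight (D * σ⁻¹) S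
  have hmem : ∀ D, w D ≠ 0 → ∀ x, D x ∈ S ↔ σ x ∈ S := fun D hD x =>
    apply_mem_iff_of_restrWeight_mul_inv_ne_zero hD x
  -- If the fixed point lies in `S`, then `b` is not mapped to `a`: otherwise `S ∪ {a}` would be
  -- invariant under `D`.
  have hin : ∀ D ∈ almostFullCycles α, w D ≠ 0 → ∀ x y, x ∈ S → D x = x → D b = y →
      x ≠ b ∧ y ∉ S ∧ y ≠ a := by
    intro D hD hwD x y hx hDx hDb
    have hm := hmem D hwD
    refine ⟨?_, ?_, ?_⟩
    · rintro rfl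
      exact hσb ((hm x).1 (hDx.symm ▸ hx))
    · rw [← hDb, hm]; exact hσb
    · rintro rfl
      obtain ⟨z, hz⟩ : ∃ z, z ∉ insert y S := by
        by_contra! h
        have h1 : insert y S = Finset.univ := Finset.eq_univ_of_forall h
        have h3 := Finset.card_insert_le y S
        rw [h1, Finset.card_univ] at h3
        omega
      have hzS : z ∉ S := fun h => hz (Finset.mem_insert_of_mem h)
      refine not_mapsTo_of_mem_almostFullCycles hD (U := insert y S) (y := y) (z := z) ?_
        (Finset.mem_insert_self _ _) hz ?_ ?_
      · intro p hp
        rcases Finset.mem_insert.1 hp with rfl | hpS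
        · exact Finset.mem_insert_of_mem ((hm _).2 hσa)
        · by_cases hpb : p = b
          · rw [hpb, hDb]; exact Finset.mem_insert_self _ _
          · refine Finset.mem_insert_of_mem ((hm p).2 ((hT p ?_ hpb).2 hpS))
            rintro rfl; exact ha hpS
      · intro h
        exact ha (eq_of_apply_eq_self hD h hDx ▸ hx)
      · intro h
        exact hzS (eq_of_apply_eq_self hD h hDx ▸ hx)
  -- If the fixed point lies outside `S`, then `a` is not mapped to `b`: otherwise `S \ {b}` would be
  -- invariant under `D`.
  have hout : ∀ D ∈ almostFullCycles α, w D ≠ 0 → ∀ x y, y ∉ S → D y = y → D x = b →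
      x ∈ S ∧ x ≠ b ∧ y ≠ a := by
    intro D hD hwD x y hy hDy hDx
    have hm := hmem D hwD
    have hxT : σ x ∈ S := (hm x).1 (hDx.symm ▸ hb)
    have hxb : x ≠ b := by rintro rfl; exact hσb hxT
    have hya : y ≠ a := by rintro rfl; exact hy (hDy ▸ (hm y).2 hσa)
    refine ⟨?_, hxb, hya⟩
    have hxa : x ≠ a := by
      rintro rfl
      obtain ⟨z, hz⟩ : (S.erase b).Nonempty := by
        rw [← Finset.card_pos, Finset.card_erase_of_mem hb]; omega
      refine not_mapsTo_of_mem_almostFullCycles hD (U := S.erase b) (y := z) (z := x) ?_ hz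
        (fun h => ha (Finset.mem_of_mem_erase h)) ?_ ?_
      · intro p hp
        obtain ⟨hpb, hpS⟩ := Finset.mem_erase.1 hp
        have hpx : p ≠ x := by rintro rfl; exact ha hpS
        refine Finset.mem_erase.2 ⟨fun h => hpx (D.injective (h.trans hDx.symm)), ?_⟩
        exact (hm p).2 ((hT p hpx hpb).2 hpS)
      · intro h
        exact hy (eq_of_apply_eq_self hD h hDy ▸ Finset.mem_of_mem_erase hz)
      · intro h
        exact hya (eq_of_apply_eq_self hD hDy h)
    exact (hT x hxa hxb).1 hxT
  -- For each pair `(x, y)`, conjugation by the 3-cycle `c` exchanges the two kinds of `D`.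
  have hpair : ∀ x y, ∑ D ∈ almostFullCycles α,
      ((if x ∈ S ∧ D x = x ∧ D b = y then w D else 0) +
        if y ∉ S ∧ D y = y ∧ D x = b then w D else 0) = 0 := by
    intro x y
    by_cases hQ : x ∈ S ∧ x ≠ b ∧ y ∉ S ∧ y ≠ a
    · obtain ⟨hx, hxb, hy, hya⟩ := hQ
      have hxy : x ≠ y := by rintro rfl; exact hy hx
      have hby : b ≠ y := by rintro rfl; exact hy hb
      set c : Perm α := swap b x * swap x y with hc
      have hcb : c b = x := by
        rw [hc, mul_apply, swap_apply_of_ne_of_ne hxb.symm hby, swap_apply_left]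
      have hcx : c x = y := by
        rw [hc, mul_apply, swap_apply_left, swap_apply_of_ne_of_ne hby.symm hxy.symm]
      have hcy : c y = b := by
        rw [hc, mul_apply, swap_apply_right, swap_apply_right]
      have hco : ∀ z, z ≠ b → z ≠ x → z ≠ y → c z = z := by
        intro z h1 h3 h4
        rw [hc, mul_apply, swap_apply_of_ne_of_ne h3 h4, swap_apply_of_ne_of_ne h1 h3]
      have hib : c⁻¹ b = y := by rw [inv_eq_iff_eq, hcy]
      have hix : c⁻¹ x = b := by rw [inv_eq_iff_eq, hcb]
      have hiy : c⁻¹ y = x := by rw [inv_eq_iff_eq, hcx]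
      rw [Finset.sum_add_distrib,
        ← sum_conj_almostFullCycles c (fun D => if y ∉ S ∧ D y = y ∧ D x = b then w D else 0),
        ← Finset.sum_add_distrib]
      refine Finset.sum_eq_zero fun D hD => ?_
      have e1 : (c * D * c⁻¹) y = y ↔ D x = x := by
        rw [mul_apply, mul_apply, hiy]
        nth_rewrite 1 [← hcx]
        rw [c.injective.eq_iff]
      have e2 : (c * D * c⁻¹) x = b ↔ D b = y := by
        rw [mul_apply, mul_apply, hix]
        nth_rewrite 2 [← hcy]
        rw [c.injective.eq_iff]
      simp only [e1, e2, hx, hy, not_false_eq_true, true_and]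
      split_ifs with h
      · obtain ⟨hDx, hDb⟩ := h
        have : w (c * D * c⁻¹) = -w D := by
          refine restrWeight_mul_inv_eq_neg_of_swap hb hx hxb.symm fun z hz => ?_
          have hzb : z ≠ b := by rintro rfl; exact hσb hz
          have hzy : z ≠ y := by rintro rfl; exact hy ((hT z hya hby.symm).1 hz)
          rw [mul_apply, mul_apply]
          by_cases hzx : z = x
          · rw [hzx, hix, hDb, hcy, hDx, swap_apply_right]
          · have hiz : c⁻¹ z = z := by rw [inv_eq_iff_eq, hco z hzb hzx hzy]
            have h1 : D z ≠ y := fun h => hzb (D.injective (h.trans hDb.symm))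
            have h3 : D z ≠ x := fun h => hzx (D.injective (h.trans hDx.symm))
            rw [hiz]
            by_cases hDz : D z = b
            · rw [hDz, hcb, swap_apply_left]
            · rw [hco _ hDz h3 h1, swap_apply_of_ne_of_ne hDz h3]
        rw [this, add_neg_cancel]
      · simp
    · refine Finset.sum_eq_zero fun D hD => ?_
      by_cases hwD : w D = 0
      · simp [hwD]
      · rw [if_neg, if_neg, add_zero]
        · rintro ⟨hy, hDy, hDx⟩
          obtain ⟨h1, h3, h4⟩ := hout D hD hwD x y hy hDy hDx
          exact hQ ⟨h1, h3, hy, h4⟩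
        · rintro ⟨hx, hDx, hDb⟩
          obtain ⟨h1, h3, h4⟩ := hin D hD hwD x y hx hDx hDb
          exact hQ ⟨hx, h1, h3, h4⟩
  -- As `D` has exactly one fixed point, the double sum over `(x, y)` has exactly one term,
  -- namely `w D`.
  have htot : ∀ D ∈ almostFullCycles α, w D = ∑ x, ∑ y,
      ((if x ∈ S ∧ D x = x ∧ D b = y then w D else 0) +
        if y ∉ S ∧ D y = y ∧ D x = b then w D else 0) := by
    intro D hD
    obtain ⟨f, hf⟩ := Finset.card_eq_one.1 (card_fixed_of_mem_almostFullCycles hD)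
    have hfix : ∀ x, D x = x ↔ x = f := fun x => by
      simpa using Finset.ext_iff.1 hf x
    have hDsymm : ∀ x, D x = b ↔ x = D.symm b := fun x => D.eq_symm_apply.symm
    have hsum1 : (∑ x, ∑ y, if x ∈ S ∧ D x = x ∧ D b = y then w D else 0) =
        if f ∈ S then w D else 0 := by
      rw [Fintype.sum_eq_single f, Fintype.sum_eq_single (D b)]
      · simp [hfix]
      · intro y hy
        exact if_neg fun h => hy h.2.2.symm
      · intro x hx
        exact Finset.sum_eq_zero fun y _ => if_neg fun h => hx ((hfix x).1 h.2.1)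
    have hsum2 : (∑ x, ∑ y, if y ∉ S ∧ D y = y ∧ D x = b then w D else 0) =
        if f ∉ S then w D else 0 := by
      rw [Fintype.sum_eq_single (D.symm b), Fintype.sum_eq_single f]
      · simp [hfix]
      · intro y hy
        exact if_neg fun h => hy ((hfix y).1 h.2.1)
      · intro x hx
        exact Finset.sum_eq_zero fun y _ => if_neg fun h => hx ((hDsymm x).1 h.2.2)
    simp only [Finset.sum_add_distrib]
    rw [hsum1, hsum2]
    by_cases hfS : f ∈ S <;> simp [hfS]
  change ∑ D ∈ almostFullCycles α, w D = 0
  rw [Finset.sum_congr rfl htot, Finset.sum_comm]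
  refine Finset.sum_eq_zero fun x _ => ?_
  rw [Finset.sum_comm]
  exact Finset.sum_eq_zero fun y _ => hpair x y

theorem sum_restrWeight_eq_zero (σ : Perm α) {S : Finset α} (h2 : 2 ≤ S.card)
    (h2' : S.card + 2 ≤ Fintype.card α) :
    ∑ D ∈ almostFullCycles α, restrWeight (D * σ⁻¹) S = 0 := by
  by_cases hmaps : ∀ x ∈ S, σ x ∈ S
  · exact sum_restrWeight_eq_zero_of_mapsTo h2 h2' hmaps
  push Not at hmaps
  obtain ⟨b, hb, hσb⟩ := hmaps
  by_cases htwo : ∃ v ∈ S, v ≠ b ∧ σ v ∉ S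
  · obtain ⟨v, hv, hvb, hσv⟩ := htwo
    exact sum_restrWeight_eq_zero_of_two hv hb hvb hσv hσb
  push Not at htwo
  set T : Finset α := Finset.univ.filter fun x => σ x ∈ S with hTdef
  have hTm : ∀ x, x ∈ T ↔ σ x ∈ S := fun x => by simp [hTdef]
  have hcard : T.card = S.card := by
    refine Finset.card_equiv σ fun x => ?_
    rw [hTm]
  have hST : S \ T = {b} := by
    ext x
    rw [Finset.mem_sdiff, hTm, Finset.mem_singleton]
    constructor
    · rintro ⟨hx, hσx⟩
      by_contra hxb
      exact hσx (htwo x hx hxb)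
    · rintro rfl
      exact ⟨hb, hσb⟩
  have hTS : (T \ S).card = 1 := by
    rw [Finset.card_sdiff_comm hcard, hST, Finset.card_singleton]
  obtain ⟨a, haTS⟩ := Finset.card_eq_one.1 hTS
  have ha : a ∈ T \ S := haTS ▸ Finset.mem_singleton_self a
  rw [Finset.mem_sdiff, hTm] at ha
  refine sum_restrWeight_eq_zero_of_exchange h2 h2' hb hσb ha.2 ha.1 fun x hxa hxb => ?_
  constructor
  · intro hx
    by_contra hxS
    have : x ∈ T \ S := by rw [Finset.mem_sdiff, hTm]; exact ⟨hx, hxS⟩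
    rw [haTS, Finset.mem_singleton] at this
    exact hxa this
  · exact fun hx => htwo x hx hxb

/-- For `N ≥ 3` points, the number of `D` with one fixed point and a cycle of length `N - 1` such
that `D σ⁻¹` is a single cycle depends on the sign of `σ` only, and is `0` for even `σ`. -/
theorem card_filter_single_orbit (h3 : 3 ≤ Fintype.card α) (σ : Perm α) (i : α) :
    (((almostFullCycles α).filter fun D => ∀ x y, (D * σ⁻¹).SameCycle x y).card : ℤ) =
      ((almostFullCycles α).filter fun D => D i = i).card * (1 - sign σ) := by
  set c : ℕ := ((almostFullCycles α).filter fun D => D i = i).card with hc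
  have hcN : Fintype.card α * c = (almostFullCycles α).card := card_mul_card_filter_apply_eq i i
  have hcuv : ∀ u v, ((almostFullCycles α).filter fun D => D u = v).card = c := fun u v =>
    Nat.eq_of_mul_eq_mul_left (by omega) ((card_mul_card_filter_apply_eq u v).trans hcN.symm)
  have hcard_erase : (Finset.univ.erase i).card = Fintype.card α - 1 := by
    rw [Finset.card_erase_of_mem (Finset.mem_univ i), Finset.card_univ]
  -- the three kinds of sets with a nonzero contribution
  have hempty : ∑ D ∈ almostFullCycles α, restrWeight (D * σ⁻¹) ∅ = Fintype.card α * c := by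
    simp only [restrWeight_empty, Finset.sum_const, nsmul_eq_mul, mul_one]
    exact_mod_cast hcN.symm
  have hsingle : ∀ s, ∑ D ∈ almostFullCycles α, restrWeight (D * σ⁻¹) {s} = -c := by
    intro s
    simp only [restrWeight_singleton, mul_apply]
    rw [← Finset.sum_filter, Finset.sum_const, hcuv]
    simp
  have htop : ∑ D ∈ almostFullCycles α, restrWeight (D * σ⁻¹) (Finset.univ.erase i) =
      -(c * sign σ) := by
    simp only [restrWeight_erase, mul_apply]
    rw [← Finset.sum_filter]
    have : ∀ D ∈ (almostFullCycles α).filter (fun D => D (σ⁻¹ i) = i),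
        (-1 : ℤ) ^ (Fintype.card α - 1) * (sign (D * σ⁻¹) : ℤ) = -sign σ := by
      intro D hD
      rw [Perm.sign_mul, Perm.sign_inv, Units.val_mul,
        sign_of_mem_almostFullCycles (Finset.mem_filter.1 hD).1]
      have h1 : ((-1 : ℤ) ^ (Fintype.card α - 1)) * (-1) ^ (Fintype.card α - 1) = 1 := by
        rw [← mul_pow]; simp
      linear_combination (-(sign σ : ℤ)) * h1
    rw [Finset.sum_congr rfl this, Finset.sum_const, hcuv]
    simp
  have hterm : ∀ S ∈ (Finset.univ.erase i).powerset,
      ∑ D ∈ almostFullCycles α, restrWeight (D * σ⁻¹) S =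
        (if S = ∅ then (Fintype.card α * c : ℤ) else 0) +
          ((∑ s ∈ Finset.univ.erase i, if S = {s} then -(c : ℤ) else 0) +
            if S = Finset.univ.erase i then -(c * sign σ : ℤ) else 0) := by
    intro S hS
    rw [Finset.mem_powerset] at hS
    have hle := Finset.card_le_card hS
    rw [hcard_erase] at hle
    have hs0 : S.card ≠ 1 → (∑ s ∈ Finset.univ.erase i, if S = {s} then -(c : ℤ) else 0) = 0 := by
      intro h
      refine Finset.sum_eq_zero fun s _ => if_neg ?_
      rintro rfl
      simp at h
    rcases Nat.lt_or_ge S.card 2 with hlt | hge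
    · rw [if_neg (c := S = Finset.univ.erase i) (by rintro rfl; omega), add_zero]
      by_cases h0 : S = ∅
      · rw [if_pos h0, hs0 (by simp [h0]), h0, hempty, add_zero]
      · have h1 : S.card = 1 := by
          have := Finset.card_pos.2 (Finset.nonempty_iff_ne_empty.2 h0)
          omega
        obtain ⟨s, rfl⟩ := Finset.card_eq_one.1 h1
        rw [if_neg h0, hsingle, zero_add]
        have hsi : s ∈ Finset.univ.erase i := hS (Finset.mem_singleton_self s)
        rw [Finset.sum_eq_single_of_mem s hsi, if_pos rfl]
        intro t _ hts
        refine if_neg fun h => hts ?_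
        exact (Finset.singleton_injective h).symm
    · rw [if_neg (c := S = ∅) (by rintro rfl; simp at hge), hs0 (by omega), zero_add, zero_add]
      split_ifs with htopS
      · rw [htopS, htop]
      · have hlt := Finset.card_lt_card (hS.ssubset_of_ne htopS)
        exact sum_restrWeight_eq_zero σ hge (by omega)
  have hcount : (((almostFullCycles α).filter fun D => ∀ x y, (D * σ⁻¹).SameCycle x y).card : ℤ) =
      ∑ D ∈ almostFullCycles α, if ∀ x y, (D * σ⁻¹).SameCycle x y then 1 else 0 := by
    rw [Finset.card_filter]; push_cast; rfl
  rw [hcount, Finset.sum_congr rfl fun D _ => (sum_restrWeight (D * σ⁻¹) i).symm,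
    Finset.sum_comm, Finset.sum_congr rfl hterm, Finset.sum_add_distrib, Finset.sum_add_distrib,
    Finset.sum_ite_eq', Finset.sum_ite_eq', Finset.sum_comm]
  have hin : ∀ s ∈ Finset.univ.erase i, ∑ S ∈ (Finset.univ.erase i).powerset,
      (if S = {s} then -(c : ℤ) else 0) = -c := by
    intro s hs
    rw [Finset.sum_ite_eq', if_pos]
    simpa using hs
  rw [Finset.sum_congr rfl hin, Finset.sum_const, hcard_erase, if_pos (by simp), if_pos (by simp),
    nsmul_eq_mul, Nat.cast_sub (by omega)]
  push_cast
  ring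

/-! ### Counting full cycles -/

theorem cycleCount_conj {n : ℕ} (c e : Perm (Fin n)) :
    cycleCount (c * e * c⁻¹) = cycleCount e := by
  rw [cycleCount, cycleCount, card_parts_partition, card_parts_partition, cycleType_conj]

theorem cycleCount_inv {n : ℕ} (e : Perm (Fin n)) : cycleCount e⁻¹ = cycleCount e := by
  rw [cycleCount, cycleCount, card_parts_partition, card_parts_partition, cycleType_inv]

theorem cycleCount_ne_zero {n : ℕ} (hn : 1 ≤ n) (e : Perm (Fin n)) : cycleCount e ≠ 0 := by
  intro h
  rw [cycleCount, Multiset.card_eq_zero] at h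
  have := e.partition.parts_sum
  rw [h, Multiset.sum_zero, Fintype.card_fin] at this
  omega

theorem cycleCount_fin_one (e : Perm (Fin 1)) : cycleCount e = 1 := by
  rw [Subsingleton.elim e 1, cycleCount, card_parts_partition, cycleType_one]
  simp

/-- The number of full cycles `ω` such that `ω * D` has exactly `k` cycles. -/
def fullCycleMulCount {n : ℕ} (D : Perm (Fin n)) (k : ℕ) : ℕ :=
  (Finset.univ.filter fun ω : Perm (Fin n) => cycleCount ω = 1 ∧ cycleCount (ω * D) = k).card

theorem fullCycleMulCount_finRotate (n k : ℕ) : fullCycleMulCount (finRotate n) k = xi n k := by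
  simp only [fullCycleMulCount, xi, isFullCycle_iff_cycleCount_eq_one]

theorem fullCycleMulCount_conj {n : ℕ} (c D : Perm (Fin n)) (k : ℕ) :
    fullCycleMulCount (c * D * c⁻¹) k = fullCycleMulCount D k := by
  symm
  refine Finset.card_equiv (MulAut.conj c).toEquiv fun ω => ?_
  have h : c * ω * c⁻¹ * (c * D * c⁻¹) = c * (ω * D) * c⁻¹ := by group
  simp [cycleCount_conj, h]

/-- Deleting the point `0`, which `D` fixes, from the full cycle `ω`: the deleted point can be
inserted again in `n` places, and the number of cycles of `ω * D` is not affected. -/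
theorem fullCycleMulCount_decomposeFin {n : ℕ} (hn : 1 ≤ n) (D : Perm (Fin n)) (k : ℕ) :
    fullCycleMulCount (decomposeFin.symm (0, D)) k = n * fullCycleMulCount D k := by
  simp only [fullCycleMulCount, Finset.card_filter]
  rw [← _root_.Equiv.sum_comp (decomposeFin (n := n)).symm, Fintype.sum_prod_type,
    Fin.sum_univ_succ]
  simp only [decomposeFin_symm_mul_zero, cycleCount_decomposeFin_symm_zero,
    cycleCount_decomposeFin_symm (Fin.succ_ne_zero _), Finset.sum_const, Finset.card_univ,
    Fintype.card_fin, smul_eq_mul]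
  rw [Finset.sum_eq_zero, zero_add]
  intro e _
  refine if_neg fun h => cycleCount_ne_zero hn e ?_
  omega

/-- Double count of the pairs `(D, σ)` such that `D ∈ A`, `σ` has `k` cycles and `D σ⁻¹` is a full
cycle, through the substitution `σ = ω D`. -/
theorem sum_fullCycleMulCount {n : ℕ} (hn : 2 ≤ n) (A : Finset (Perm (Fin n))) (k : ℕ) :
    ∑ D ∈ A, fullCycleMulCount D k =
      ∑ σ : Perm (Fin n) with cycleCount σ = k,
        (A.filter fun D => ∀ x y, (D * σ⁻¹).SameCycle x y).card := by
  simp only [Finset.card_filter]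
  rw [Finset.sum_comm]
  refine Finset.sum_congr rfl fun D _ => ?_
  rw [fullCycleMulCount, ← Finset.card_filter, Finset.filter_filter]
  refine Finset.card_equiv (Equiv.mulRight D) fun ω => ?_
  have h : D * (ω * D)⁻¹ = ω⁻¹ := by group
  simp only [Finset.mem_filter, Finset.mem_univ, true_and, Equiv.coe_mulRight, h]
  rw [← isFullCycle_iff_forall_sameCycle hn, isFullCycle_iff_cycleCount_eq_one, cycleCount_inv,
    and_comm]

/-- The permutations `σ` counted on the left are odd, so that each of them arises from the same
number of full cycles. -/
theorem two_mul_stirlingCount_of_two_le {n k : ℕ} (hn : 2 ≤ n) (h : Even (n + k)) :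
    2 * stirlingCount (n + 1) k = n * (n + 1) * xi n k := by
  set D₀ : Perm (Fin (n + 1)) := decomposeFin.symm (0, finRotate n) with hD₀
  have hmem : D₀ ∈ almostFullCycles (Fin (n + 1)) := by
    rw [mem_almostFullCycles, hD₀, cycleType_decomposeFin_symm_zero, cycleType_finRotate_of_le hn]
    simp
  set c : ℕ := ((almostFullCycles (Fin (n + 1))).filter fun D => D 0 = 0).card with hc
  have hcpos : 0 < c := Finset.card_pos.2
    ⟨D₀, Finset.mem_filter.2 ⟨hmem, decomposeFin_symm_apply_zero 0 _⟩⟩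
  have hcard : (n + 1) * c = (almostFullCycles (Fin (n + 1))).card := by
    have := card_mul_card_filter_apply_eq (0 : Fin (n + 1)) 0
    rwa [Fintype.card_fin] at this
  have hconst : ∀ D ∈ almostFullCycles (Fin (n + 1)),
      fullCycleMulCount D k = n * xi n k := by
    intro D hD
    have hconj : IsConj D₀ D := by
      rw [isConj_iff_cycleType_eq, mem_almostFullCycles.1 hD, mem_almostFullCycles.1 hmem]
    obtain ⟨g, rfl⟩ := isConj_iff.1 hconj
    rw [fullCycleMulCount_conj, hD₀, fullCycleMulCount_decomposeFin (by omega),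
      fullCycleMulCount_finRotate]
  have hf : ∀ σ ∈ Finset.univ.filter (fun σ : Perm (Fin (n + 1)) => cycleCount σ = k),
      ((almostFullCycles (Fin (n + 1))).filter
        fun D => ∀ x y, (D * σ⁻¹).SameCycle x y).card = 2 * c := by
    intro σ hσ
    have hs : (sign σ : ℤ) = -1 := by
      rw [sign_eq_neg_one_pow, (Finset.mem_filter.1 hσ).2, add_right_comm, pow_succ, h.neg_one_pow]
      simp
    have := card_filter_single_orbit (by rw [Fintype.card_fin]; omega) σ 0
    rw [hs] at this
    have h2 : (((almostFullCycles (Fin (n + 1))).filter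
        fun D => ∀ x y, (D * σ⁻¹).SameCycle x y).card : ℤ) = 2 * c := by
      rw [show (2 * c : ℤ) = c * (1 - -1) by ring]
      convert this
    exact_mod_cast h2
  have hdouble := sum_fullCycleMulCount (by omega) (almostFullCycles (Fin (n + 1))) k
  rw [Finset.sum_congr rfl hconst, Finset.sum_congr rfl hf, Finset.sum_const, Finset.sum_const,
    ← hcard, smul_eq_mul, smul_eq_mul] at hdouble
  change (n + 1) * c * (n * xi n k) = stirlingCount (n + 1) k * (2 * c) at hdouble
  refine Nat.eq_of_mul_eq_mul_left hcpos ?_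
  linarith

theorem stirlingCount_two (k : ℕ) :
    stirlingCount 2 k = (if 2 = k then 1 else 0) + if 1 = k then 1 else 0 := by
  rw [stirlingCount, Finset.card_filter, ← _root_.Equiv.sum_comp (decomposeFin (n := 1)).symm,
    Fintype.sum_prod_type, Fin.sum_univ_succ]
  simp only [cycleCount_decomposeFin_symm_zero, cycleCount_fin_one,
    cycleCount_decomposeFin_symm (Fin.succ_ne_zero _)]
  simp

theorem xi_one (k : ℕ) : xi 1 k = if 1 = k then 1 else 0 := by
  rw [← fullCycleMulCount_finRotate, fullCycleMulCount, Finset.card_filter]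
  simp only [cycleCount_fin_one]
  simp

theorem two_mul_stirlingCount {n k : ℕ} (hn : 1 ≤ n) (h : Even (n + k)) :
    2 * stirlingCount (n + 1) k = n * (n + 1) * xi n k := by
  rcases hn.eq_or_lt with rfl | hn
  · have hk : 2 ≠ k := by
      rintro rfl
      exact absurd h (by decide)
    rw [stirlingCount_two, xi_one, if_neg hk]
    ring
  · exact two_mul_stirlingCount_of_two_le hn h

theorem xi_eq_zero_of_odd {n k : ℕ} (hn : 1 ≤ n) (h : Odd (n + k)) : xi n k = 0 := by
  rw [← fullCycleMulCount_finRotate, fullCycleMulCount, Finset.card_eq_zero,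
    Finset.filter_eq_empty_iff]
  rintro ω - ⟨h1, hk⟩
  have hs := sign_eq_neg_one_pow (ω * finRotate n)
  rw [hk, h.neg_one_pow, Perm.sign_mul, sign_eq_neg_one_pow ω, h1, sign_finRotate, ← pow_add,
    Even.neg_one_pow ⟨n, by omega⟩] at hs
  exact absurd hs (by decide)

end CycleProduct

theorem mainTheorem1 (n k : ℕ) (hn : 1 ≤ n) (hk : 1 ≤ k) :
    (Even ((n : ℤ) - (k : ℤ)) →
      (CycleProduct.xi n k : ℚ) =
        2 / ((n : ℚ) * ((n : ℚ) + 1)) * (CycleProduct.stirlingCount (n + 1) k : ℚ)) ∧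
    (Odd ((n : ℤ) - (k : ℤ)) → CycleProduct.xi n k = 0) := by
  constructor
  · intro h
    have hmul : (2 * CycleProduct.stirlingCount (n + 1) k : ℚ) =
        n * (n + 1) * CycleProduct.xi n k := by
      exact_mod_cast CycleProduct.two_mul_stirlingCount hn (by rw [Int.even_sub] at h; grind)
    have h0 : (n : ℚ) ≠ 0 := by exact_mod_cast (by omega : n ≠ 0)
    have h1 : (n : ℚ) + 1 ≠ 0 := by positivity
    rw [div_mul_eq_mul_div, eq_div_iff (mul_ne_zero h0 h1), hmul]
    ring
  · intro h
    refine CycleProduct.xi_eq_zero_of_odd hn ?_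
    rw [Int.odd_sub] at h
    rw [Nat.odd_add]
    exact_mod_cast h
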